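/- Cones live in $\mathbb{R}^2$. A *ray* is a set $\mathbb{R}_{\ge 0}v$ with $v\in\mathbb{Z}^2\setminus\{0\}$; its generator is the first nonzero lattice point on it. A *sector* is a set $\mathbb{R}_{\ge 0}v_1+\mathbb{R}_{\ge 0}v_2$ with $v_1,v_2\in\mathbb{Z}^2$ linearly independent; it is *regular* if the generators of its two boundary rays form a basis of $\mathbb{Z}^2$. A *fan* is a set of cones consisting of $\{0\}$, finitely many rays in counterclockwise order, and the sectors between consecutive rays, where these sectors cover $\mathbb{R}^2$; it is regular if all its sectors are. A fan $\Delta'$ *refines* a fan $\Delta$ if they have the same support and every cone of $\Delta'$ is contained in a cone of $\Delta$. A fan is *compatible* with a map $F:\mathbb{R}^2\to\mathbb{R}^2$ if $F$ agrees with a linear map on each sector of the fan. A *piecewise linear automorphism of $\mathbb{Z}^2$* is an orientation-preserving homeomorphism $F:\mathbb{R}^2\to\mathbb{R}^2$ with $F(\mathbb{Z}^2)=\mathbb{Z}^2$ for which there is a compatible fan (orientation-preserving means that each of the linear pieces of $F$ has positive determinant). For a fan $\Delta'$, the *approximate map* $F_\sharp:\Delta'\to\Delta'$ is the partial function sending a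 cone $\sigma\in\Delta'$ to the smallest cone of $\Delta'$ containing $F(\sigma)$; $F_\sharp\sigma$ is undefined if no cone of $\Delta'$ contains $F(\sigma)$. A cone $\tau\in\Delta'$ is *deterministic* for $F_\sharp$ if $(F_\sharp)^j\tau$ is defined for all $j\ge 1$. **Proposition.** For every piecewise linear automorphism $F$ of $\mathbb{Z}^2$ and every fan $\Delta$ there is a refinement $\Delta'$ of $\Delta$ such that $\Delta'$ is regular and compatible with $F$, and every ray in $\Delta'$ is deterministic for $F_\sharp:\Delta'\to\Delta'$. -/

import Mathlib

namespace PLFan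

/-- The real plane. -/
abbrev Plane : Type := ℝ × ℝ

/-- The inclusion of the lattice `ℤ²` in the plane. -/
def latt (v : ℤ × ℤ) : Plane := ((v.1 : ℝ), (v.2 : ℝ))

/-- The determinant of the matrix with columns `v` and `w`. -/
def det (v w : ℤ × ℤ) : ℤ := v.1 * w.2 - v.2 * w.1

/-- `ℝ₊ v`. -/
def ray (v : ℤ × ℤ) : Set Plane :=
  {x | ∃ s : ℝ, 0 ≤ s ∧ x = s • latt v}

/-- `ℝ₊ v + ℝ₊ w`. -/
def sector (v w : ℤ × ℤ) : Set Plane :=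
  {x | ∃ s t : ℝ, 0 ≤ s ∧ 0 ≤ t ∧ x = s • latt v + t • latt w}

/-- A ray: a rational one-dimensional cone. -/
def IsRay (τ : Set Plane) : Prop := ∃ v : ℤ × ℤ, v ≠ 0 ∧ τ = ray v

/-- `v` is the generator of the ray `τ`: the first nonzero lattice point on it. -/
def IsGenerator (v : ℤ × ℤ) (τ : Set Plane) : Prop :=
  v ≠ 0 ∧ τ = ray v ∧
    ∀ w : ℤ × ℤ, w ≠ 0 → latt w ∈ τ → ∃ t : ℝ, 1 ≤ t ∧ latt w = t • latt v

/-- A regular sector: the generators of its two facets form a basis of `ℤ²`. -/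
def IsRegularSector (σ : Set Plane) : Prop :=
  ∃ v w : ℤ × ℤ, IsGenerator v (ray v) ∧ IsGenerator w (ray w) ∧
    σ = sector v w ∧ |det v w| = 1

/-- The sectors between consecutive rays of a collection `R` of rays: `ℝ₊ v + ℝ₊ w` with
`ℝ₊ v, ℝ₊ w ∈ R`, where `ℝ₊ w` follows `ℝ₊ v` counterclockwise at an angle less than `π` and
no further ray of `R` lies in between. -/
def sectorsBetween (R : Set (Set Plane)) : Set (Set Plane) :=
  {σ | ∃ v w : ℤ × ℤ, 0 < det v w ∧ ray v ∈ R ∧ ray w ∈ R ∧ σ = sector v w ∧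
    ∀ τ ∈ R, τ ⊆ σ → τ = ray v ∨ τ = ray w}

/-- A (complete) fan. Its cones are `{0}`, finitely many rays, and the sectors between
consecutive rays; these sectors cover the plane. The rays determine the fan. -/
structure Fan where
  rays : Set (Set Plane)
  finite_rays : rays.Finite
  isRay_of_mem : ∀ τ ∈ rays, IsRay τ
  complete : ⋃₀ sectorsBetween rays = Set.univ

namespace Fan

/-- The sectors of a fan. -/
def sectors (Δ : Fan) : Set (Set Plane) := sectorsBetween Δ.rays

/-- All cones of a fan. -/
def cones (Δ : Fan) : Set (Set Plane) := {{0}} ∪ Δ.rays ∪ Δ.sectors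

/-- The support of a fan: the union of its cones. -/
def supp (Δ : Fan) : Set Plane := ⋃₀ Δ.cones

/-- A fan is regular if all its sectors are. -/
def Regular (Δ : Fan) : Prop := ∀ σ ∈ Δ.sectors, IsRegularSector σ

/-- `Δ'.Refines Δ`: the fan `Δ'` is a refinement of `Δ`. -/
def Refines (Δ' Δ : Fan) : Prop :=
  Δ'.supp = Δ.supp ∧ ∀ σ' ∈ Δ'.cones, ∃ σ ∈ Δ.cones, σ' ⊆ σ

/-- `Δ` is compatible with `F`: on every sector of `Δ`, `F` agrees with a linear map. -/
def Compatible (Δ : Fan) (F : Plane → Plane) : Prop :=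
  ∀ σ ∈ Δ.sectors, ∃ L : Plane →ₗ[ℝ] Plane, Set.EqOn F L σ

end Fan

/-- Piecewise linear maps of the plane. -/
def IsPiecewiseLinear (F : Plane → Plane) : Prop :=
  Continuous F ∧ ∃ Δ : Fan, Δ.Compatible F

/-- A piecewise linear map preserves orientation if each of its linear pieces does.
(A linear map is determined by its restriction to a sector.) -/
def PreservesOrientation (F : Plane → Plane) : Prop :=
  ∀ Δ : Fan, Δ.Compatible F → ∀ σ ∈ Δ.sectors, ∀ L : Plane →ₗ[ℝ] Plane,
    Set.EqOn F L σ → 0 < LinearMap.det L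

/-- Piecewise linear automorphisms of `ℤ²`. -/
structure IsPLAut (F : Plane → Plane) : Prop where
  piecewiseLinear : IsPiecewiseLinear F
  homeomorph : IsHomeomorph F
  preservesOrientation : PreservesOrientation F
  image_lattice : F '' Set.range latt = Set.range latt

/-- The approximate map `F_♯ : Δ → Δ'`, a partial function: `F_♯ σ` is the smallest cone of
`Δ'` (for inclusion) that contains `F(σ)`, and is undefined if there is none. -/
noncomputable def approxMap (F : Plane → Plane) (Δ Δ' : Fan) : Δ.cones →. Δ'.cones :=
  fun σ => ⟨∃ κ : Δ'.cones, IsLeast {κ : Δ'.cones | F '' σ.1 ⊆ κ.1} κ, fun h => h.choose⟩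

/-- The iterates `(F_♯)^j` of the approximate self-map `F_♯ : Δ → Δ`. -/
noncomputable def approxIter (F : Plane → Plane) (Δ : Fan) : ℕ → (Δ.cones →. Δ.cones)
  | 0 => PFun.id _
  | j + 1 => (approxMap F Δ Δ).comp (approxIter F Δ j)

/-- The cone `σ` is deterministic for `F_♯ : Δ → Δ`: all `(F_♯)^j σ` with `j ≥ 1` are defined. -/
def Deterministic (F : Plane → Plane) (Δ : Fan) (σ : Δ.cones) : Prop :=
  ∀ j : ℕ, 1 ≤ j → (approxIter F Δ j σ).Dom

end PLFan

/-!
A fan is encoded by the finite set `V ⊆ ℤ²` of the generators of its rays; it is regular if any two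
consecutive vectors of `V` have determinant one (`IsRegularSystem`). An automorphism `F` restricts
to a bijection `φ` of `ℤ²` that preserves primitive vectors, and it maps a regular sector on which
it is linear onto a regular sector (`IsLatticeLift.det_apply_eq_one`).

A regular fan that refines `Δ` and is compatible with `F` exists: the primitive vectors in a large
box form a regular system (`isRegularSystem_primitiveBox`). It is then subdivided further, until
all rays are deterministic, in the way birational surface maps are made algebraically stable by
blowing up the orbits that lead from contracted curves to indeterminate points.

Suppose that some ray is not deterministic. Then there are sectors `σ₁, …, σₙ` of `V` such that the
interior of `σ₁` contains `φ v` for some `v ∈ V`, such that `F σᵢ = σᵢ₊₁`, and such that `F σₙ` is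
subdivided by `V`. (If `F σᵢ` lies in `σᵢ₊₁` but differs from it, then the image of a boundary ray
of `σᵢ` lies in the interior of `σᵢ₊₁`, and the chain may start there.) Let `mᵢ` be the sum of the
generators of `σᵢ`, so that `φ mᵢ = mᵢ₊₁` for `i < n`. Replace `V` by `V ∪ {m₁, …, mₙ}`, which is
again regular.

This stops after finitely many steps. Let `Z` be a regular system that contains `V` and `φ V`. If a
regular sector bounded by vectors of `Z` is subdivided by `Z`, then the sum of its generators
belongs to `Z` (`IsRegularSystem.add_mem`). Hence `m₁ ∈ Z` and `φ mₙ ∈ Z`, so that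
`Z ∪ {m₁, …, mₙ}` contains the new `V` and its image under `φ`. The number of vectors of `Z` missing
in `V` has decreased, because `m₁ ∈ Z` is no longer missing and the vectors added to `Z` were also
added to `V` (`exists_card_sdiff_lt`).
-/

namespace PLFan

/-! ### Determinants -/

/-- The determinant of two vectors of the real plane. -/
def rdet (x y : Plane) : ℝ := x.1 * y.2 - x.2 * y.1

lemma rdet_latt (v w : ℤ × ℤ) : rdet (latt v) (latt w) = (det v w : ℝ) := by
  simp [rdet, latt, det]

lemma latt_injective : Function.Injective latt := by
  intro v w h
  simp only [latt, Prod.mk.injEq, Int.cast_inj] at h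
  exact Prod.ext h.1 h.2

lemma latt_add (v w : ℤ × ℤ) : latt (v + w) = latt v + latt w := by
  simp [latt]

lemma latt_smul (k : ℤ) (v : ℤ × ℤ) : latt (k • v) = (k : ℝ) • latt v := by
  simp [latt]

lemma latt_ne_zero {v : ℤ × ℤ} (hv : v ≠ 0) : latt v ≠ 0 := by
  intro h
  exact hv (latt_injective (h.trans (by simp [latt]; rfl)))

lemma det_self (v : ℤ × ℤ) : det v v = 0 := by simp only [det]; ring

lemma det_swap (v w : ℤ × ℤ) : det w v = - det v w := by simp only [det]; ring

lemma det_add_right (u v w : ℤ × ℤ) : det u (v + w) = det u v + det u w := by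
  simp only [det, Prod.fst_add, Prod.snd_add]; ring

lemma det_add_left (u v w : ℤ × ℤ) : det (u + v) w = det u w + det v w := by
  simp only [det, Prod.fst_add, Prod.snd_add]; ring

/-- The Plücker relation for four vectors of the lattice. -/
lemma det_mul_det (a b c d : ℤ × ℤ) :
    det a c * det b d = det a b * det c d + det a d * det b c := by
  simp only [det]; ring

/-- Cramer's rule: the coordinates of `x` in terms of `v` and `w`. -/
lemma rdet_smul (v w x : Plane) : rdet v w • x = rdet x w • v + rdet v x • w := by
  ext <;> simp [rdet] <;> ring

lemma isCoprime_of_det_eq_one {v w : ℤ × ℤ} (h : det v w = 1) : IsCoprime w.1 w.2 :=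
  ⟨-v.2, v.1, by simp only [det] at h; linarith⟩

lemma exists_eq_smul_of_det_eq_zero {v w : ℤ × ℤ} (hv : IsCoprime v.1 v.2) (h : det v w = 0) :
    ∃ k : ℤ, w = k • v := by
  obtain ⟨p, q, hpq⟩ := hv
  simp only [det] at h
  refine ⟨p * w.1 + q * w.2, Prod.ext ?_ ?_⟩
  · simp only [Prod.smul_fst, smul_eq_mul]
    linear_combination (-w.1) * hpq - q * h
  · simp only [Prod.smul_snd, smul_eq_mul]
    linear_combination (-w.2) * hpq + p * h

/-- A primitive vector is determined by its direction. -/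
lemma eq_of_det_eq_zero {v w x : ℤ × ℤ} (hv : IsCoprime v.1 v.2) (hw : IsCoprime w.1 w.2)
    (h : det v w = 0) (hxv : 0 < det v x) (hxw : 0 < det w x) : v = w := by
  obtain ⟨k, hk⟩ := exists_eq_smul_of_det_eq_zero hv h
  obtain ⟨l, hl⟩ := exists_eq_smul_of_det_eq_zero hw (by rw [det_swap, h, neg_zero])
  have h1 : det w x = k * det v x := by rw [hk]; simp [det]; ring
  have h2 : det v x = l * det w x := by rw [hl]; simp [det]; ring
  have hk0 : 0 < k := by
    rw [h1] at hxw
    exact pos_of_mul_pos_left hxw hxv.le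
  have hkl : k * l = 1 := by
    have : (k * l - 1) * det w x = 0 := by linear_combination (-1 : ℤ) * h1 - k * h2
    rcases mul_eq_zero.1 this with h | h
    · linarith
    · omega
  have : k = 1 := Int.eq_one_of_mul_eq_one_right hk0.le hkl
  rw [hk, this, one_smul]

lemma exists_primitive {v : ℤ × ℤ} (hv : v ≠ 0) :
    ∃ (k : ℤ) (u : ℤ × ℤ), 0 < k ∧ IsCoprime u.1 u.2 ∧ v = k • u := by
  have hg : 0 < Int.gcd v.1 v.2 := by
    rw [Int.gcd_pos_iff]
    by_contra! h
    exact hv (Prod.ext h.1 h.2)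
  obtain ⟨m, n, hmn, h1, h2⟩ := Int.exists_gcd_one hg
  refine ⟨Int.gcd v.1 v.2, (m, n), by exact_mod_cast hg, Int.isCoprime_iff_gcd_eq_one.2 hmn, ?_⟩
  ext
  · simpa [mul_comm] using h1
  · simpa [mul_comm] using h2

/-- Two primitive vectors which do not form a basis of the lattice span a sector that contains a
lattice point in the interior of the triangle `0, a, b`, or on its edge from `a` to `b`. -/
lemma exists_det_eq_one {a b : ℤ × ℤ} (ha : IsCoprime a.1 a.2) (hb : IsCoprime b.1 b.2)
    (h : 1 < det a b) : ∃ u, det a u = 1 ∧ 0 < det u b ∧ det u b < det a b := by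
  obtain ⟨p, q, hpq⟩ := ha
  set c : ℤ × ℤ := (-q, p) with hc
  have hac : det a c = 1 := by simp only [det, hc]; linarith
  set k := det c b / det a b with hk
  set u : ℤ × ℤ := c + (-k) • a with hu
  have hau : det a u = 1 := by
    rw [hu, det_add_right, hac]; simp [det]; ring
  have hub : det u b = det c b % det a b := by
    have : det u b = det c b - det a b * k := by
      rw [hu, det_add_left]; simp [det]; ring
    rw [this, hk, Int.emod_def]
  have hlt : det u b < det a b := hub ▸ Int.emod_lt_of_pos _ (by omega)
  have hge : 0 ≤ det u b := hub ▸ Int.emod_nonneg _ (by omega)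
  refine ⟨u, hau, lt_of_le_of_ne hge fun h0 => ?_, hlt⟩
  -- If `u` were parallel to `b`, then `u = l • b`, so that `1 = det a u` is a multiple of `det a b`.
  obtain ⟨l, hl⟩ := exists_eq_smul_of_det_eq_zero hb (w := u) (by rw [det_swap, ← h0, neg_zero])
  have h1 : det a b * l = 1 := by
    rw [← hau, hl]; simp [det]; ring
  have := Int.eq_one_of_mul_eq_one_right (by omega) h1
  omega

/-! ### Rays and sectors -/

lemma mem_sector_iff {v w : ℤ × ℤ} (h : 0 < det v w) {x : Plane} :
    x ∈ sector v w ↔ 0 ≤ rdet (latt v) x ∧ 0 ≤ rdet x (latt w) := by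
  have hd : (0 : ℝ) < rdet (latt v) (latt w) := by rw [rdet_latt]; exact_mod_cast h
  constructor
  · rintro ⟨s, t, hs, ht, rfl⟩
    have h1 : rdet (latt v) (s • latt v + t • latt w) = t * rdet (latt v) (latt w) := by
      simp [rdet]; ring
    have h2 : rdet (s • latt v + t • latt w) (latt w) = s * rdet (latt v) (latt w) := by
      simp [rdet]; ring
    rw [h1, h2]
    exact ⟨by positivity, by positivity⟩
  · rintro ⟨h1, h2⟩
    refine ⟨rdet x (latt w) / rdet (latt v) (latt w), rdet (latt v) x / rdet (latt v) (latt w),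
      by positivity, by positivity, ?_⟩
    have := congrArg (fun y => (rdet (latt v) (latt w))⁻¹ • y) (rdet_smul (latt v) (latt w) x)
    simp only [smul_add, smul_smul, inv_mul_cancel₀ hd.ne', one_smul] at this
    rw [div_eq_inv_mul, div_eq_inv_mul]
    exact this

lemma latt_mem_sector_iff {v w u : ℤ × ℤ} (h : 0 < det v w) :
    latt u ∈ sector v w ↔ 0 ≤ det v u ∧ 0 ≤ det u w := by
  rw [mem_sector_iff h, rdet_latt, rdet_latt, Int.cast_nonneg_iff, Int.cast_nonneg_iff]

lemma latt_mem_ray (v : ℤ × ℤ) : latt v ∈ ray v := ⟨1, zero_le_one, (one_smul _ _).symm⟩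

lemma smul_mem_sector {v w : ℤ × ℤ} {x : Plane} {s : ℝ} (hs : 0 ≤ s) (hx : x ∈ sector v w) :
    s • x ∈ sector v w := by
  obtain ⟨p, q, hp, hq, rfl⟩ := hx
  exact ⟨s * p, s * q, by positivity, by positivity, by rw [smul_add, smul_smul, smul_smul]⟩

lemma add_mem_sector {v w : ℤ × ℤ} {x y : Plane} (hx : x ∈ sector v w) (hy : y ∈ sector v w) :
    x + y ∈ sector v w := by
  obtain ⟨p, q, hp, hq, rfl⟩ := hx
  obtain ⟨p', q', hp', hq', rfl⟩ := hy
  exact ⟨p + p', q + q', by positivity, by positivity, by module⟩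

lemma left_mem_sector (v w : ℤ × ℤ) : latt v ∈ sector v w :=
  ⟨1, 0, zero_le_one, le_rfl, by simp⟩

lemma right_mem_sector (v w : ℤ × ℤ) : latt w ∈ sector v w :=
  ⟨0, 1, le_rfl, zero_le_one, by simp⟩

lemma ray_subset_sector {u v w : ℤ × ℤ} (h : latt u ∈ sector v w) : ray u ⊆ sector v w := by
  rintro _ ⟨s, hs, rfl⟩
  exact smul_mem_sector hs h

lemma sector_subset_sector {a b v w : ℤ × ℤ} (ha : latt a ∈ sector v w)
    (hb : latt b ∈ sector v w) : sector a b ⊆ sector v w := by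
  rintro _ ⟨s, t, hs, ht, rfl⟩
  exact add_mem_sector (smul_mem_sector hs ha) (smul_mem_sector ht hb)

lemma ray_smul {k : ℤ} (hk : 0 < k) (u : ℤ × ℤ) : ray (k • u) = ray u := by
  have hk' : (0 : ℝ) < k := by exact_mod_cast hk
  ext x
  constructor
  · rintro ⟨s, hs, rfl⟩
    exact ⟨s * k, by positivity, by rw [latt_smul, smul_smul]⟩
  · rintro ⟨s, hs, rfl⟩
    refine ⟨s / k, by positivity, ?_⟩
    rw [latt_smul, smul_smul, div_mul_cancel₀ _ hk'.ne']

lemma exists_smul_eq_of_mem_ray {u v : ℤ × ℤ} (hu : u ≠ 0) (h : latt u ∈ ray v) :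
    ∃ s : ℝ, 0 < s ∧ latt u = s • latt v := by
  obtain ⟨s, hs, h⟩ := h
  refine ⟨s, lt_of_le_of_ne hs ?_, h⟩
  rintro rfl
  exact latt_ne_zero hu (by rw [h, zero_smul])

lemma ne_zero_of_isCoprime {v : ℤ × ℤ} (h : IsCoprime v.1 v.2) : v ≠ 0 := by
  rintro rfl
  exact not_isCoprime_zero_zero h

lemma left_ne_zero {v w : ℤ × ℤ} (h : 0 < det v w) : v ≠ 0 := by
  rintro rfl
  simp [det] at h

/-- A sector, together with its orientation, depends only on its boundary rays. -/
lemma sector_congr {a b v w : ℤ × ℤ} (ha : a ≠ 0) (hb : b ≠ 0) (hav : ray a = ray v)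
    (hbw : ray b = ray w) (h : 0 < det v w) : 0 < det a b ∧ sector a b = sector v w := by
  obtain ⟨s, hs, hsv⟩ := exists_smul_eq_of_mem_ray ha (hav ▸ latt_mem_ray a)
  obtain ⟨t, ht, htw⟩ := exists_smul_eq_of_mem_ray hb (hbw ▸ latt_mem_ray b)
  constructor
  · have h1 : ((det a b : ℤ) : ℝ) = s * t * (det v w : ℤ) := by
      rw [← rdet_latt, ← rdet_latt, hsv, htw]; simp [rdet]; ring
    have h2 : (0 : ℝ) < (det v w : ℤ) := by exact_mod_cast h
    have h3 : (0 : ℝ) < ((det a b : ℤ) : ℝ) := by rw [h1]; positivity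
    exact_mod_cast h3
  · apply Set.Subset.antisymm
    · apply sector_subset_sector
      · rw [hsv]; exact smul_mem_sector hs.le (left_mem_sector _ _)
      · rw [htw]; exact smul_mem_sector ht.le (right_mem_sector _ _)
    · apply sector_subset_sector
      · obtain ⟨r, hr, h⟩ : latt v ∈ ray a := hav ▸ latt_mem_ray v
        rw [h]; exact smul_mem_sector hr (left_mem_sector _ _)
      · obtain ⟨r, hr, h⟩ : latt w ∈ ray b := hbw ▸ latt_mem_ray w
        rw [h]; exact smul_mem_sector hr (right_mem_sector _ _)

lemma det_eq_zero_of_mem_ray {u v : ℤ × ℤ} (h : latt u ∈ ray v) : det v u = 0 := by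
  obtain ⟨s, -, hs⟩ := h
  have : ((det v u : ℤ) : ℝ) = 0 := by rw [← rdet_latt, hs]; simp [rdet]; ring
  exact_mod_cast this

/-- If the sector of `c, d` contains an interior point `x` of the sector of `a, b`, and neither `c`
nor `d` lies in the interior of the sector of `a, b`, then the sector of `c, d` contains the
sector of `a, b`. -/
lemma sector_subset_of_inside {a b c d x : ℤ × ℤ} (hab : 0 < det a b) (hax : 0 < det a x)
    (hxb : 0 < det x b) (hcd : 0 < det c d) (hcx : 0 ≤ det c x) (hxd : 0 ≤ det x d)
    (hc : ¬ (0 < det a c ∧ 0 < det c b)) (hd : ¬ (0 < det a d ∧ 0 < det d b)) :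
    sector a b ⊆ sector c d := by
  -- `det c d • x = det x d • c + det c x • d`, so `x` is parallel to `c` or `d` if a coefficient
  -- vanishes; this is excluded by `hc` and `hd`.
  have e1 : det c d * det a x = det x d * det a c + det c x * det a d := by simp only [det]; ring
  have e2 : det c d * det x b = det x d * det c b + det c x * det d b := by simp only [det]; ring
  have p1 := mul_pos hcd hax
  have p2 := mul_pos hcd hxb
  have hcx' : 0 < det c x := by
    refine lt_of_le_of_ne hcx fun h => hc ?_
    rw [← h, zero_mul, add_zero] at e1 e2
    exact ⟨pos_of_mul_pos_right (e1 ▸ p1) hxd,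
      pos_of_mul_pos_right (e2 ▸ p2) hxd⟩
  have hxd' : 0 < det x d := by
    refine lt_of_le_of_ne hxd fun h => hd ?_
    rw [← h, zero_mul, zero_add] at e1 e2
    exact ⟨pos_of_mul_pos_right (e1 ▸ p1) hcx,
      pos_of_mul_pos_right (e2 ▸ p2) hcx⟩
  have hca : 0 ≤ det c a := by
    by_contra! h
    rw [det_swap] at h
    have h' : 0 < det a c := by omega
    have := det_mul_det a c x b
    exact hc ⟨h', pos_of_mul_pos_right
      (this ▸ add_pos (mul_pos h' hxb) (mul_pos hab hcx')) hax.le⟩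
  have hbd : 0 ≤ det b d := by
    by_contra! h
    rw [det_swap] at h
    have h' : 0 < det d b := by omega
    have := det_mul_det a x d b
    have h2 : 0 < det a d * det x b := by
      rw [this]; exact add_pos (mul_pos hax h') (mul_pos hab hxd')
    exact hd ⟨pos_of_mul_pos_left h2 hxb.le, h'⟩
  have had : 0 < det a d := by
    have := det_mul_det c a x d
    have h2 : 0 < det c x * det a d := by
      rw [this]; exact add_pos_of_nonneg_of_pos (mul_nonneg hca hxd) (mul_pos hcd hax)
    exact pos_of_mul_pos_right h2 hcx
  have hcb : 0 < det c b := by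
    have := det_mul_det c x b d
    have h2 : 0 < det c b * det x d := by
      rw [this]; exact add_pos_of_nonneg_of_pos (mul_nonneg hcx hbd) (mul_pos hcd hxb)
    exact pos_of_mul_pos_left h2 hxd
  exact sector_subset_sector ((latt_mem_sector_iff hcd).2 ⟨hca, had.le⟩)
    ((latt_mem_sector_iff hcd).2 ⟨hcb.le, hbd⟩)

/-! ### Consecutive vectors -/

/-- `a` and `b` lie in `V`, the vector `b` follows `a` counterclockwise at an angle less than `π`,
and no vector of `V` lies strictly in between. -/
structure Consecutive (V : Finset (ℤ × ℤ)) (a b : ℤ × ℤ) : Prop where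
  left_mem : a ∈ V
  right_mem : b ∈ V
  det_pos : 0 < det a b
  not_inside : ∀ u ∈ V, ¬ (0 < det a u ∧ 0 < det u b)

/-- A finite set of primitive vectors containing `±e₁` and `±e₂`, in which any two consecutive
vectors form a basis of the lattice. These are the generators of the rays of a regular fan which
refines the fan of the four quadrants; the four vectors guarantee completeness. -/
structure IsRegularSystem (V : Finset (ℤ × ℤ)) : Prop where
  coords_subset : {(1, 0), (0, 1), (-1, 0), (0, -1)} ⊆ V
  isCoprime : ∀ v ∈ V, IsCoprime v.1 v.2
  det_eq_one : ∀ a b, Consecutive V a b → det a b = 1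

/-- Among the sectors with boundary in `V` containing `x`, one with the least number of vectors
of `V` in its interior has consecutive boundary vectors. -/
lemma exists_consecutive {V : Finset (ℤ × ℤ)}
    (hV : {(1, 0), (0, 1), (-1, 0), (0, -1)} ⊆ V) (x : Plane) :
    ∃ a b, Consecutive V a b ∧ x ∈ sector a b := by
  classical
  let inside : (ℤ × ℤ) × (ℤ × ℤ) → Finset (ℤ × ℤ) := fun p =>
    V.filter fun u => 0 < det p.1 u ∧ 0 < det u p.2
  let S := (V ×ˢ V).filter fun p => 0 < det p.1 p.2 ∧ x ∈ sector p.1 p.2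
  have hS : S.Nonempty := by
    have h1 : ((1, 0) : ℤ × ℤ) ∈ V := hV (by simp)
    have h2 : ((0, 1) : ℤ × ℤ) ∈ V := hV (by simp)
    have h3 : ((-1, 0) : ℤ × ℤ) ∈ V := hV (by simp)
    have h4 : ((0, -1) : ℤ × ℤ) ∈ V := hV (by simp)
    have key : ∀ a b : ℤ × ℤ, a ∈ V → b ∈ V → 0 < det a b → 0 ≤ rdet (latt a) x →
        0 ≤ rdet x (latt b) → S.Nonempty := fun a b ha hb hab hx hx' =>
      ⟨(a, b), Finset.mem_filter.2
        ⟨Finset.mk_mem_product ha hb, hab, (mem_sector_iff hab).2 ⟨hx, hx'⟩⟩⟩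
    rcases le_total 0 x.1 with hx | hx <;> rcases le_total 0 x.2 with hy | hy
    · exact key _ _ h1 h2 (by simp [det]) (by simpa [rdet, latt]) (by simpa [rdet, latt])
    · exact key _ _ h4 h1 (by simp [det]) (by simpa [rdet, latt]) (by simpa [rdet, latt])
    · exact key _ _ h2 h3 (by simp [det]) (by simpa [rdet, latt]) (by simpa [rdet, latt])
    · exact key _ _ h3 h4 (by simp [det]) (by simpa [rdet, latt]) (by simpa [rdet, latt])
  obtain ⟨⟨a, b⟩, hp, hmin⟩ := S.exists_min_image (fun p => (inside p).card) hS
  simp only [S, Finset.mem_filter, Finset.mem_product] at hp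
  obtain ⟨⟨ha, hb⟩, hab, hx⟩ := hp
  refine ⟨a, b, ⟨ha, hb, hab, ?_⟩, hx⟩
  rintro u hu ⟨hau, hub⟩
  -- A vector `u` in between splits the sector in two, one of which contains `x`.
  have hx' := (mem_sector_iff hab).1 hx
  rcases le_total 0 (rdet (latt u) x) with h | h
  · have hmem : (u, b) ∈ S := Finset.mem_filter.2
      ⟨Finset.mk_mem_product hu hb, hub, (mem_sector_iff hub).2 ⟨h, hx'.2⟩⟩
    refine (hmin _ hmem).not_gt (Finset.card_lt_card (Finset.ssubset_iff_subset_ne.2 ⟨?_, ?_⟩))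
    · intro y hy
      simp only [inside, Finset.mem_filter] at hy ⊢
      obtain ⟨hyV, h1, h2⟩ := hy
      have := det_mul_det a u y b
      have h3 : 0 < det a y * det u b := by
        rw [this]; exact add_pos (mul_pos hau h2) (mul_pos hab h1)
      exact ⟨hyV, pos_of_mul_pos_left h3 hub.le, h2⟩
    · intro heq
      have : u ∈ inside (u, b) := heq ▸ Finset.mem_filter.2 ⟨hu, hau, hub⟩
      simp [inside, det_self] at this
  · have hmem : (a, u) ∈ S := by
      refine Finset.mem_filter.2
        ⟨Finset.mk_mem_product ha hu, hau, (mem_sector_iff hau).2 ⟨hx'.1, ?_⟩⟩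
      have : rdet x (latt u) = - rdet (latt u) x := by simp only [rdet]; ring
      rw [this]; linarith
    refine (hmin _ hmem).not_gt (Finset.card_lt_card (Finset.ssubset_iff_subset_ne.2 ⟨?_, ?_⟩))
    · intro y hy
      simp only [inside, Finset.mem_filter] at hy ⊢
      obtain ⟨hyV, h1, h2⟩ := hy
      have := det_mul_det a y u b
      have h3 : 0 < det a u * det y b := by
        rw [this]; exact add_pos (mul_pos h1 hub) (mul_pos hab h2)
      exact ⟨hyV, h1, pos_of_mul_pos_right h3 hau.le⟩
    · intro heq
      have : u ∈ inside (a, u) := heq ▸ Finset.mem_filter.2 ⟨hu, hau, hub⟩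
      simp [inside, det_self] at this

/-! ### Regular systems -/

namespace IsRegularSystem

variable {V : Finset (ℤ × ℤ)}

/-- If a basis of the lattice consists of vectors of a regular system and the sector spanned by it
is subdivided by the system at all, then it is subdivided by the sum of the two vectors. -/
lemma add_mem (hV : IsRegularSystem V) {v w u : ℤ × ℤ} (hv : v ∈ V) (hw : w ∈ V) (hu : u ∈ V)
    (hvw : det v w = 1) (hvu : 0 < det v u) (huw : 0 < det u w) : v + w ∈ V := by
  obtain ⟨a, b, hab, hmem⟩ := exists_consecutive hV.coords_subset (latt (v + w))
  have hab1 := hV.det_eq_one a b hab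
  rw [latt_mem_sector_iff hab.det_pos] at hmem
  obtain ⟨ht, hs⟩ := hmem
  have e1 : 1 = det (v + w) b * det v a + det a (v + w) * det v b := by
    have : det a b * det v (v + w) = det (v + w) b * det v a + det a (v + w) * det v b := by
      simp only [det]; ring
    rw [← this, hab1, det_add_right, det_self, hvw]; rfl
  have e2 : 1 = det (v + w) b * det a w + det a (v + w) * det b w := by
    have : det a b * det (v + w) w = det (v + w) b * det a w + det a (v + w) * det b w := by
      simp only [det]; ring
    rw [← this, hab1, det_add_left, det_self, hvw]; rfl
  have hcr : v + w = det (v + w) b • a + det a (v + w) • b := by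
    have : det a b • (v + w) = det (v + w) b • a + det a (v + w) • b := by
      ext <;> simp [det] <;> ring
    rw [← this, hab1, one_smul]
  have hva := hab.not_inside v hv
  have hwa := hab.not_inside w hw
  generalize hs' : det (v + w) b = s at *
  generalize ht' : det a (v + w) = t at *
  rcases ht.eq_or_lt with rfl | ht
  · rw [zero_mul, add_zero] at e1
    have : s = 1 := Int.eq_one_of_mul_eq_one_right hs e1.symm
    rw [hcr, this, zero_smul, one_smul, add_zero]
    exact hab.left_mem
  rcases hs.eq_or_lt with rfl | hs
  · rw [zero_mul, zero_add] at e1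
    have : t = 1 := Int.eq_one_of_mul_eq_one_right ht.le e1.symm
    rw [hcr, this, zero_smul, one_smul, zero_add]
    exact hab.right_mem
  -- Otherwise `v + w` is a combination with positive coefficients of `a` and `b`, which are in turn
  -- combinations of `v` and `w` with coefficients in `ℕ`. This forces `a = v` and `b = w`.
  exfalso
  have hvw0 : 0 < det v w := by omega
  have hsub : sector a b ⊆ sector v w := by
    refine sector_subset_of_inside (x := v + w) hab.det_pos (ht'.symm ▸ ht) (hs'.symm ▸ hs) hvw0
      ?_ ?_ hva hwa
    · rw [det_add_right, det_self]; omega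
    · rw [det_add_left, det_self]; omega
  obtain ⟨hq, hp⟩ := (latt_mem_sector_iff hvw0).1 (hsub (left_mem_sector a b))
  obtain ⟨hq', hp'⟩ := (latt_mem_sector_iff hvw0).1 (hsub (right_mem_sector a b))
  have e3 : det a w * det v b = 1 + det v a * det b w := by
    have : det a w * det v b = det v w * det a b + det v a * det b w := by
      simp only [det]; ring
    rw [this, hvw, hab1]; rfl
  have h3 : 0 < det a w * det v b := by
    rw [e3]; have := mul_nonneg hq hp'; omega
  have hp1 : 0 < det a w := pos_of_mul_pos_left h3 hq'
  have hq1 : 0 < det v b := pos_of_mul_pos_right h3 hp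
  have hq0 : det v a = 0 := by
    have := mul_pos ht hq1
    have : s * det v a ≤ 0 := by omega
    nlinarith
  have hp0 : det b w = 0 := by
    have := mul_pos hs hp1
    have : t * det b w ≤ 0 := by omega
    nlinarith
  refine hab.not_inside u hu ⟨?_, ?_⟩
  · have : det v w * det a u = det a w * det v u - det v a * det u w := by
      simp only [det]; ring
    rw [hvw, one_mul, hq0, zero_mul, sub_zero] at this
    rw [this]; exact mul_pos hp1 hvu
  · have : det v w * det u b = det v b * det u w - det v u * det b w := by
      simp only [det]; ring
    rw [hvw, one_mul, hp0, mul_zero, sub_zero] at this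
    rw [this]; exact mul_pos hq1 huw

/-- Subdividing a regular sector by the sum of its generators preserves regularity. -/
lemma insert_add (hV : IsRegularSystem V) {v w : ℤ × ℤ} (hv : v ∈ V) (hw : w ∈ V)
    (hvw : det v w = 1) : IsRegularSystem (insert (v + w) V) := by
  by_cases hm : v + w ∈ V
  · rwa [Finset.insert_eq_of_mem hm]
  have hno : ∀ u ∈ V, ¬ (0 < det v u ∧ 0 < det u w) := fun u hu h =>
    hm (hV.add_mem hv hw hu hvw h.1 h.2)
  have hvm : det v (v + w) = 1 := by rw [det_add_right, det_self, hvw]; rfl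
  have hmw : det (v + w) w = 1 := by rw [det_add_left, det_self, hvw]; rfl
  refine ⟨hV.coords_subset.trans (Finset.subset_insert _ _), ?_, ?_⟩
  · intro x hx
    rcases Finset.mem_insert.1 hx with rfl | hx
    · exact isCoprime_of_det_eq_one hvm
    · exact hV.isCoprime x hx
  · rintro a b ⟨ha, hb, hab, hins⟩
    have hinsv := hins v (Finset.mem_insert_of_mem hv)
    have hinsw := hins w (Finset.mem_insert_of_mem hw)
    rcases Finset.mem_insert.1 ha with rfl | ha <;> rcases Finset.mem_insert.1 hb with rfl | hb
    · rw [det_self] at hab; omega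
    · -- The vector following `v + w` is `w`.
      have h1 : ¬ 0 < det w b := fun h => hinsw ⟨by omega, h⟩
      have h2 : ¬ 0 < det b w := fun h => hno b hb ⟨by
        have := det_mul_det v (v + w) b w
        rw [hvm, hmw, hvw] at this
        omega, h⟩
      rw [det_swap] at h2
      have : w = b := eq_of_det_eq_zero (x := -(v + w)) (hV.isCoprime w hw) (hV.isCoprime b hb)
        (by omega) (by rw [show det w (-(v + w)) = det (v + w) w by simp [det]; ring]; omega)
        (by rw [show det b (-(v + w)) = det (v + w) b by simp [det]; ring]; omega)
      rw [← this, hmw]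
    · -- The vector preceding `v + w` is `v`.
      have h1 : ¬ 0 < det a v := fun h => hinsv ⟨h, by omega⟩
      have h2 : ¬ 0 < det v a := fun h => hno a ha ⟨h, by
        have := det_mul_det v a (v + w) w
        rw [hvm, hmw, hvw] at this
        omega⟩
      rw [det_swap] at h2
      have : a = v := eq_of_det_eq_zero (x := v + w) (hV.isCoprime a ha) (hV.isCoprime v hv)
        (by omega) hab (by omega)
      rw [this, hvm]
    · exact hV.det_eq_one a b ⟨ha, hb, hab, fun u hu => hins u (Finset.mem_insert_of_mem hu)⟩

lemma union_add (hV : IsRegularSystem V) {M : Finset (ℤ × ℤ)}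
    (hM : ∀ m ∈ M, ∃ v w, v ∈ V ∧ w ∈ V ∧ det v w = 1 ∧ m = v + w) :
    IsRegularSystem (V ∪ M) := by
  induction M using Finset.induction_on with
  | empty => simpa using hV
  | insert m M _ ih =>
    obtain ⟨v, w, hv, hw, hvw, rfl⟩ := hM m (Finset.mem_insert_self _ _)
    rw [Finset.union_insert]
    exact (ih fun m hm => hM m (Finset.mem_insert_of_mem hm)).insert_add
      (Finset.mem_union_left _ hv) (Finset.mem_union_left _ hw) hvw

end IsRegularSystem

open Classical in
/-- The primitive vectors of maximum norm at most `N`. -/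
noncomputable def primitiveBox (N : ℤ) : Finset (ℤ × ℤ) :=
  (Finset.Icc (-N) N ×ˢ Finset.Icc (-N) N).filter fun v => IsCoprime v.1 v.2

lemma mem_primitiveBox {N : ℤ} {v : ℤ × ℤ} :
    v ∈ primitiveBox N ↔ (|v.1| ≤ N ∧ |v.2| ≤ N) ∧ IsCoprime v.1 v.2 := by
  simp [primitiveBox, abs_le]

/-- If two consecutive vectors of the box were not a basis, then the triangle spanned by them would
contain a further primitive vector. -/
lemma isRegularSystem_primitiveBox {N : ℤ} (hN : 1 ≤ N) : IsRegularSystem (primitiveBox N) := by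
  refine ⟨?_, fun v hv => (mem_primitiveBox.1 hv).2, ?_⟩
  · intro v hv
    simp only [Finset.mem_insert, Finset.mem_singleton] at hv
    rw [mem_primitiveBox]
    rcases hv with rfl | rfl | rfl | rfl <;>
      simp [isCoprime_one_left, isCoprime_one_right, IsCoprime.neg_left_iff,
        IsCoprime.neg_right_iff] <;>
      omega
  · intro a b hab
    by_contra hne
    have hd : 1 < det a b := by have := hab.det_pos; omega
    obtain ⟨⟨ha1, ha2⟩, ha⟩ := mem_primitiveBox.1 hab.left_mem
    obtain ⟨⟨hb1, hb2⟩, hb⟩ := mem_primitiveBox.1 hab.right_mem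
    obtain ⟨u, hau, hub, hlt⟩ := exists_det_eq_one ha hb hd
    refine hab.not_inside u (mem_primitiveBox.2 ⟨?_, isCoprime_of_det_eq_one hau⟩)
      ⟨by omega, hub⟩
    have key : ∀ x y z : ℤ, |x| ≤ N → |y| ≤ N → det a b * z = det u b * x + y → |z| ≤ N := by
      intro x y z hx hy h
      rw [abs_le] at *
      constructor <;> nlinarith
    refine ⟨key _ _ _ ha1 hb1 ?_, key _ _ _ ha2 hb2 ?_⟩
    · have : det a b * u.1 = det u b * a.1 + det a u * b.1 := by simp only [det]; ring
      rw [this, hau, one_mul]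
    · have : det a b * u.2 = det u b * a.2 + det a u * b.2 := by simp only [det]; ring
      rw [this, hau, one_mul]

lemma exists_subset_primitiveBox (S : Finset (ℤ × ℤ)) (hS : ∀ v ∈ S, IsCoprime v.1 v.2) :
    ∃ N : ℤ, 1 ≤ N ∧ S ⊆ primitiveBox N := by
  induction S using Finset.induction_on with
  | empty => exact ⟨1, le_rfl, by simp⟩
  | insert v S _ ih =>
    obtain ⟨N, hN, hSN⟩ := ih fun u hu => hS u (Finset.mem_insert_of_mem hu)
    refine ⟨max N (max |v.1| |v.2|), hN.trans (le_max_left _ _), ?_⟩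
    intro u hu
    rw [mem_primitiveBox]
    rcases Finset.mem_insert.1 hu with rfl | hu
    · exact ⟨⟨by simp, by simp⟩, hS _ (Finset.mem_insert_self _ _)⟩
    · obtain ⟨⟨h1, h2⟩, h3⟩ := mem_primitiveBox.1 (hSN hu)
      exact ⟨⟨h1.trans (le_max_left _ _), h2.trans (le_max_left _ _)⟩, h3⟩

/-! ### The fan of a regular system -/

lemma mem_sectorsBetween_iff {V : Finset (ℤ × ℤ)} (hV : ∀ v ∈ V, IsCoprime v.1 v.2)
    {σ : Set Plane} :
    σ ∈ sectorsBetween (ray '' V) ↔ ∃ a b, Consecutive V a b ∧ σ = sector a b := by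
  constructor
  · rintro ⟨v, w, hvw, ⟨a, ha, hav⟩, ⟨b, hb, hbw⟩, rfl, hbetween⟩
    obtain ⟨hab, heq⟩ := sector_congr (ne_zero_of_isCoprime (hV a ha))
      (ne_zero_of_isCoprime (hV b hb)) hav hbw hvw
    refine ⟨a, b, ⟨ha, hb, hab, ?_⟩, heq.symm⟩
    rintro u hu ⟨hau, hub⟩
    have hmem : latt u ∈ sector v w :=
      heq ▸ (latt_mem_sector_iff hab).2 ⟨hau.le, hub.le⟩
    rcases hbetween (ray u) ⟨u, hu, rfl⟩ (ray_subset_sector hmem) with h | h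
    · have := det_eq_zero_of_mem_ray (hav ▸ h ▸ latt_mem_ray u : latt u ∈ ray a)
      omega
    · have := det_eq_zero_of_mem_ray (hbw ▸ h ▸ latt_mem_ray u : latt u ∈ ray b)
      rw [det_swap] at this
      omega
  · rintro ⟨a, b, hab, rfl⟩
    refine ⟨a, b, hab.det_pos, ⟨a, hab.left_mem, rfl⟩, ⟨b, hab.right_mem, rfl⟩, rfl, ?_⟩
    rintro _ ⟨u, hu, rfl⟩ hsub
    obtain ⟨h1, h2⟩ := (latt_mem_sector_iff hab.det_pos).1 (hsub (latt_mem_ray u))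
    rcases h1.eq_or_lt with h1 | h1
    · left
      rcases h2.eq_or_lt with h2 | h2
      · -- Only the zero vector is parallel to both `a` and `b`.
        have e : det a b • u = det u b • a + det a u • b := by ext <;> simp [det] <;> ring
        rw [← h1, ← h2, zero_smul, zero_smul, zero_add] at e
        rcases smul_eq_zero.1 e with h | h
        · exact absurd h hab.det_pos.ne'
        · exact absurd h (ne_zero_of_isCoprime (hV u hu))
      · rw [eq_of_det_eq_zero (hV a hab.left_mem) (hV u hu) h1.symm hab.det_pos h2]
    · right
      rcases h2.eq_or_lt with h2 | h2
      · congr 1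
        refine eq_of_det_eq_zero (x := -a) (hV u hu) (hV b hab.right_mem) h2.symm ?_ ?_
        · rwa [show det u (-a) = det a u by simp [det]; ring]
        · rw [show det b (-a) = det a b by simp [det]; ring]; exact hab.det_pos
      · exact absurd ⟨h1, h2⟩ (hab.not_inside u hu)

lemma isGenerator_ray {v : ℤ × ℤ} (hv : IsCoprime v.1 v.2) : IsGenerator v (ray v) := by
  refine ⟨ne_zero_of_isCoprime hv, rfl, fun w hw hwv => ?_⟩
  obtain ⟨s, hs, hsw⟩ := exists_smul_eq_of_mem_ray hw hwv
  obtain ⟨k, rfl⟩ := exists_eq_smul_of_det_eq_zero hv (det_eq_zero_of_mem_ray hwv)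
  rw [latt_smul] at hsw
  have hks : (k : ℝ) = s :=
    smul_left_injective ℝ (latt_ne_zero (ne_zero_of_isCoprime hv)) hsw
  refine ⟨k, ?_, latt_smul _ _⟩
  have : (0 : ℝ) < k := hks ▸ hs
  exact_mod_cast this

namespace IsRegularSystem

variable {V : Finset (ℤ × ℤ)}

/-- The fan whose rays are spanned by the vectors of a regular system. -/
def toFan (hV : IsRegularSystem V) : Fan where
  rays := ray '' V
  finite_rays := V.finite_toSet.image _
  isRay_of_mem := by
    rintro _ ⟨v, hv, rfl⟩
    exact ⟨v, ne_zero_of_isCoprime (hV.isCoprime v hv), rfl⟩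
  complete := by
    rw [Set.eq_univ_iff_forall]
    intro x
    obtain ⟨a, b, hab, hx⟩ := exists_consecutive hV.coords_subset x
    exact ⟨_, (mem_sectorsBetween_iff hV.isCoprime).2 ⟨a, b, hab, rfl⟩, hx⟩

lemma mem_sectors_toFan (hV : IsRegularSystem V) {σ : Set Plane} :
    σ ∈ hV.toFan.sectors ↔ ∃ a b, Consecutive V a b ∧ σ = sector a b :=
  mem_sectorsBetween_iff hV.isCoprime

lemma regular_toFan (hV : IsRegularSystem V) : hV.toFan.Regular := by
  intro σ hσ
  obtain ⟨a, b, hab, rfl⟩ := hV.mem_sectors_toFan.1 hσ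
  exact ⟨a, b, isGenerator_ray (hV.isCoprime a hab.left_mem),
    isGenerator_ray (hV.isCoprime b hab.right_mem), rfl, by rw [hV.det_eq_one a b hab]; rfl⟩

end IsRegularSystem

lemma Fan.exists_mem_sectors (Δ : Fan) (x : Plane) : ∃ σ ∈ Δ.sectors, x ∈ σ := by
  have := Δ.complete.symm ▸ Set.mem_univ x
  exact this

lemma Fan.supp_eq_univ (Δ : Fan) : Δ.supp = Set.univ := by
  rw [Set.eq_univ_iff_forall]
  intro x
  obtain ⟨σ, hσ, hx⟩ := Δ.exists_mem_sectors x
  exact ⟨σ, Or.inr hσ, hx⟩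

lemma Fan.exists_eq_sector {Δ : Fan} {σ : Set Plane} (hσ : σ ∈ Δ.sectors) :
    ∃ v w, 0 < det v w ∧ ray v ∈ Δ.rays ∧ ray w ∈ Δ.rays ∧ σ = sector v w := by
  obtain ⟨v, w, h, hv, hw, rfl, -⟩ := hσ
  exact ⟨v, w, h, hv, hw, rfl⟩

lemma Fan.exists_primitive_finset (Δ : Fan) :
    ∃ S : Finset (ℤ × ℤ), (∀ v ∈ S, IsCoprime v.1 v.2) ∧ Δ.rays ⊆ ray '' S := by
  classical
  have h : ∀ τ ∈ Δ.rays, ∃ u : ℤ × ℤ, IsCoprime u.1 u.2 ∧ ray u = τ := by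
    intro τ hτ
    obtain ⟨v, hv, rfl⟩ := Δ.isRay_of_mem τ hτ
    obtain ⟨k, u, hk, hu, rfl⟩ := exists_primitive hv
    exact ⟨u, hu, (ray_smul hk u).symm⟩
  choose! g hg using h
  refine ⟨Δ.finite_rays.toFinset.image g, ?_, ?_⟩
  · intro v hv
    obtain ⟨τ, hτ, rfl⟩ := Finset.mem_image.1 hv
    exact (hg τ (by simpa using hτ)).1
  · intro τ hτ
    exact ⟨g τ, Finset.mem_coe.2 (Finset.mem_image_of_mem _ (by simpa using hτ)), (hg τ hτ).2⟩

/-- If `V` spans at least the rays of `Δ`, then the sectors of `V` lie in sectors of `Δ`. -/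
lemma Fan.exists_sector_superset {Δ : Fan} {V : Finset (ℤ × ℤ)}
    (hV : ∀ v ∈ V, IsCoprime v.1 v.2) (hΔ : Δ.rays ⊆ ray '' V) {a b : ℤ × ℤ}
    (hab : Consecutive V a b) : ∃ σ ∈ Δ.sectors, sector a b ⊆ σ := by
  obtain ⟨σ, hσ, hx⟩ := Δ.exists_mem_sectors (latt (a + b))
  refine ⟨σ, hσ, ?_⟩
  obtain ⟨v, w, hvw, hv, hw, rfl⟩ := Fan.exists_eq_sector hσ
  obtain ⟨c, hc, hcv⟩ := hΔ hv
  obtain ⟨d, hd, hdw⟩ := hΔ hw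
  obtain ⟨hcd, heq⟩ := sector_congr (ne_zero_of_isCoprime (hV c hc))
    (ne_zero_of_isCoprime (hV d hd)) hcv hdw hvw
  rw [← heq] at hx ⊢
  obtain ⟨h1, h2⟩ := (latt_mem_sector_iff hcd).1 hx
  refine sector_subset_of_inside hab.det_pos ?_ ?_ hcd h1 h2 (hab.not_inside c hc)
    (hab.not_inside d hd)
  · rw [det_add_right, det_self, zero_add]; exact hab.det_pos
  · rw [det_add_left, det_self, add_zero]; exact hab.det_pos

namespace IsRegularSystem

variable {V : Finset (ℤ × ℤ)}

lemma refines_toFan (hV : IsRegularSystem V) {Δ : Fan} (hΔ : Δ.rays ⊆ ray '' V) :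
    hV.toFan.Refines Δ := by
  refine ⟨by rw [Fan.supp_eq_univ, Fan.supp_eq_univ], ?_⟩
  rintro σ' ((rfl | hσ') | hσ')
  · exact ⟨{0}, Or.inl (Or.inl rfl), subset_rfl⟩
  · obtain ⟨v, -, rfl⟩ := hσ'
    obtain ⟨σ, hσ, hv⟩ := Δ.exists_mem_sectors (latt v)
    refine ⟨σ, Or.inr hσ, ?_⟩
    obtain ⟨c, d, -, -, -, rfl⟩ := Fan.exists_eq_sector hσ
    exact ray_subset_sector hv
  · obtain ⟨a, b, hab, rfl⟩ := hV.mem_sectors_toFan.1 hσ'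
    obtain ⟨σ, hσ, h⟩ := Fan.exists_sector_superset hV.isCoprime hΔ hab
    exact ⟨σ, Or.inr hσ, h⟩

lemma sector_mem_cones (hV : IsRegularSystem V) {a b : ℤ × ℤ} (hab : Consecutive V a b) :
    sector a b ∈ hV.toFan.cones :=
  Or.inr (hV.mem_sectors_toFan.2 ⟨a, b, hab, rfl⟩)

lemma ray_mem_cones (hV : IsRegularSystem V) {v : ℤ × ℤ} (hv : v ∈ V) :
    ray v ∈ hV.toFan.cones :=
  Or.inl (Or.inr ⟨v, hv, rfl⟩)

/-- A sector of the fan lies in every cone of the fan that contains an interior point of it. -/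
lemma sector_subset_of_mem_cones (hV : IsRegularSystem V) {a b x : ℤ × ℤ}
    (hab : Consecutive V a b) (hax : 0 < det a x) (hxb : 0 < det x b) {κ : Set Plane}
    (hκ : κ ∈ hV.toFan.cones) (hx : latt x ∈ κ) : sector a b ⊆ κ := by
  rcases hκ with (rfl | ⟨u, hu, rfl⟩) | hκ
  · exact absurd hx (latt_ne_zero (left_ne_zero hxb))
  · obtain ⟨s, hs, hsx⟩ := exists_smul_eq_of_mem_ray (left_ne_zero hxb) hx
    have h1 : ((det a x : ℤ) : ℝ) = s * (det a u : ℤ) := by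
      rw [← rdet_latt, ← rdet_latt, hsx]; simp [rdet]; ring
    have h2 : ((det x b : ℤ) : ℝ) = s * (det u b : ℤ) := by
      rw [← rdet_latt, ← rdet_latt, hsx]; simp [rdet]; ring
    have h3 : (0 : ℝ) < (det a x : ℤ) := by exact_mod_cast hax
    have h4 : (0 : ℝ) < (det x b : ℤ) := by exact_mod_cast hxb
    rw [h1] at h3
    rw [h2] at h4
    exact absurd ⟨by exact_mod_cast pos_of_mul_pos_right h3 hs.le,
      by exact_mod_cast pos_of_mul_pos_right h4 hs.le⟩ (hab.not_inside u hu)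
  · obtain ⟨c, d, hcd, rfl⟩ := hV.mem_sectors_toFan.1 hκ
    obtain ⟨h1, h2⟩ := (latt_mem_sector_iff hcd.det_pos).1 hx
    exact sector_subset_of_inside hab.det_pos hax hxb hcd.det_pos h1 h2
      (hab.not_inside c hcd.left_mem) (hab.not_inside d hcd.right_mem)

end IsRegularSystem

/-! ### Piecewise linear automorphisms on the lattice -/

lemma rdet_map (L : Plane →ₗ[ℝ] Plane) (x y : Plane) :
    rdet (L x) (L y) = LinearMap.det L * rdet x y := by
  have hL : ∀ z : Plane, L z = z.1 • L (1, 0) + z.2 • L (0, 1) := by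
    intro z
    rw [← map_smul, ← map_smul, ← map_add]
    simp
  have hdet : LinearMap.det L = rdet (L (1, 0)) (L (0, 1)) := by
    rw [← LinearMap.det_toMatrix (Module.Basis.finTwoProd ℝ), Matrix.det_fin_two]
    simp [LinearMap.toMatrix_apply, rdet]
    ring
  rw [hdet, hL x, hL y]
  simp only [rdet, Prod.fst_add, Prod.snd_add, Prod.smul_fst, Prod.smul_snd, smul_eq_mul]
  ring

/-- `F` is a piecewise linear automorphism compatible with the fan `Δ₀`, and `φ` is its restriction
to the lattice. -/
structure IsLatticeLift (F : Plane → Plane) (Δ₀ : Fan) (φ : ℤ × ℤ → ℤ × ℤ) : Prop where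
  isPLAut : IsPLAut F
  compatible : Δ₀.Compatible F
  latt_apply : ∀ v, latt (φ v) = F (latt v)

namespace IsLatticeLift

variable {F : Plane → Plane} {Δ₀ : Fan} {φ : ℤ × ℤ → ℤ × ℤ}

lemma map_smul (h : IsLatticeLift F Δ₀ φ) {s : ℝ} (hs : 0 ≤ s) (x : Plane) :
    F (s • x) = s • F x := by
  obtain ⟨σ, hσ, hx⟩ := Δ₀.exists_mem_sectors x
  obtain ⟨L, hL⟩ := h.compatible σ hσ
  obtain ⟨v, w, -, -, -, rfl⟩ := Fan.exists_eq_sector hσ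
  rw [hL hx, hL (smul_mem_sector hs hx), _root_.map_smul]

lemma injective (h : IsLatticeLift F Δ₀ φ) : Function.Injective φ := by
  intro v w hvw
  apply latt_injective
  apply h.isPLAut.homeomorph.injective
  rw [← h.latt_apply, ← h.latt_apply, hvw]

lemma surjective (h : IsLatticeLift F Δ₀ φ) : Function.Surjective φ := by
  intro u
  obtain ⟨_, ⟨v, rfl⟩, hv⟩ : latt u ∈ F '' Set.range latt :=
    h.isPLAut.image_lattice.symm.subset (Set.mem_range_self u)
  exact ⟨v, latt_injective ((h.latt_apply v).trans hv)⟩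

lemma apply_smul (h : IsLatticeLift F Δ₀ φ) {k : ℤ} (hk : 0 ≤ k) (v : ℤ × ℤ) :
    φ (k • v) = k • φ v := by
  apply latt_injective
  rw [h.latt_apply, latt_smul, latt_smul, h.map_smul (by exact_mod_cast hk), h.latt_apply]

lemma isCoprime (h : IsLatticeLift F Δ₀ φ) {v : ℤ × ℤ} (hv : IsCoprime v.1 v.2) :
    IsCoprime (φ v).1 (φ v).2 := by
  have h0 : φ 0 = 0 := by simpa using h.apply_smul (le_refl 0) 0
  have hne : φ v ≠ 0 := fun e => ne_zero_of_isCoprime hv (h.injective (e.trans h0.symm))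
  obtain ⟨k, u, hk, hu, hku⟩ := exists_primitive hne
  obtain ⟨u', rfl⟩ := h.surjective u
  rw [← h.apply_smul hk.le] at hku
  have hv' := h.injective hku
  have hunit : IsUnit k := hv.isUnit_of_dvd' ⟨u'.1, by rw [hv']; rfl⟩ ⟨u'.2, by rw [hv']; rfl⟩
  have : k = 1 := by rcases Int.isUnit_iff.1 hunit with h | h <;> omega
  rw [hv', this, one_smul]
  exact hu

lemma image_ray (h : IsLatticeLift F Δ₀ φ) (v : ℤ × ℤ) : F '' ray v = ray (φ v) := by
  ext y
  constructor
  · rintro ⟨_, ⟨s, hs, rfl⟩, rfl⟩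
    exact ⟨s, hs, by rw [h.map_smul hs, h.latt_apply]⟩
  · rintro ⟨s, hs, rfl⟩
    exact ⟨s • latt v, ⟨s, hs, rfl⟩, by rw [h.map_smul hs, h.latt_apply]⟩

variable {V : Finset (ℤ × ℤ)} {a b : ℤ × ℤ}

lemma exists_linear (h : IsLatticeLift F Δ₀ φ) (hV : IsRegularSystem V)
    (hΔ : Δ₀.rays ⊆ ray '' V) (hab : Consecutive V a b) :
    ∃ L : Plane →ₗ[ℝ] Plane, 0 < LinearMap.det L ∧ Set.EqOn F L (sector a b) := by
  obtain ⟨σ, hσ, hsub⟩ := Fan.exists_sector_superset hV.isCoprime hΔ hab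
  obtain ⟨L, hL⟩ := h.compatible σ hσ
  exact ⟨L, h.isPLAut.preservesOrientation Δ₀ h.compatible σ hσ L hL, hL.mono hsub⟩

lemma map_add (h : IsLatticeLift F Δ₀ φ) (hV : IsRegularSystem V)
    (hΔ : Δ₀.rays ⊆ ray '' V) (hab : Consecutive V a b) : φ (a + b) = φ a + φ b := by
  obtain ⟨L, -, hL⟩ := h.exists_linear hV hΔ hab
  apply latt_injective
  rw [h.latt_apply, latt_add, latt_add, h.latt_apply, h.latt_apply, hL (left_mem_sector a b),
    hL (right_mem_sector a b), hL (add_mem_sector (left_mem_sector a b) (right_mem_sector a b)),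
    _root_.map_add]

lemma map_combination (h : IsLatticeLift F Δ₀ φ) (hV : IsRegularSystem V)
    (hΔ : Δ₀.rays ⊆ ray '' V) (hab : Consecutive V a b) {s t : ℝ} (hs : 0 ≤ s) (ht : 0 ≤ t) :
    F (s • latt a + t • latt b) = s • latt (φ a) + t • latt (φ b) := by
  obtain ⟨L, -, hL⟩ := h.exists_linear hV hΔ hab
  rw [hL ⟨s, t, hs, ht, rfl⟩, _root_.map_add, _root_.map_smul, _root_.map_smul, h.latt_apply,
    h.latt_apply, hL (left_mem_sector a b), hL (right_mem_sector a b)]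

lemma image_sector (h : IsLatticeLift F Δ₀ φ) (hV : IsRegularSystem V)
    (hΔ : Δ₀.rays ⊆ ray '' V) (hab : Consecutive V a b) :
    F '' sector a b = sector (φ a) (φ b) := by
  ext y
  constructor
  · rintro ⟨_, ⟨s, t, hs, ht, rfl⟩, rfl⟩
    exact ⟨s, t, hs, ht, h.map_combination hV hΔ hab hs ht⟩
  · rintro ⟨s, t, hs, ht, rfl⟩
    exact ⟨_, ⟨s, t, hs, ht, rfl⟩, h.map_combination hV hΔ hab hs ht⟩

/-- A piecewise linear automorphism maps regular sectors on which it is linear to regular sectors,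
because it maps the lattice points of the sector onto those of the image. -/
lemma det_apply_eq_one (h : IsLatticeLift F Δ₀ φ) (hV : IsRegularSystem V)
    (hΔ : Δ₀.rays ⊆ ray '' V) (hab : Consecutive V a b) : det (φ a) (φ b) = 1 := by
  have hpos : 0 < det (φ a) (φ b) := by
    obtain ⟨L, hdet, hL⟩ := h.exists_linear hV hΔ hab
    have h1 := rdet_map L (latt a) (latt b)
    rw [← hL (left_mem_sector a b), ← hL (right_mem_sector a b), ← h.latt_apply, ← h.latt_apply,
      rdet_latt, rdet_latt, hV.det_eq_one a b hab, Int.cast_one, mul_one] at h1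
    rw [← h1] at hdet
    exact_mod_cast hdet
  by_contra hne
  obtain ⟨u, h1, h2, h3⟩ := exists_det_eq_one (h.isCoprime (hV.isCoprime a hab.left_mem))
    (h.isCoprime (hV.isCoprime b hab.right_mem)) (by omega : 1 < det (φ a) (φ b))
  obtain ⟨q, rfl⟩ := h.surjective u
  -- `q` is a combination of `a` and `b` with integral coefficients, and so is its image `u`.
  have hq : latt q ∈ sector a b := by
    have hmem : latt (φ q) ∈ F '' sector a b := by
      rw [h.image_sector hV hΔ hab, latt_mem_sector_iff hpos]
      exact ⟨by omega, h2.le⟩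
    obtain ⟨x, hx, hxq⟩ := hmem
    rw [h.latt_apply] at hxq
    rwa [← h.isPLAut.homeomorph.injective hxq]
  obtain ⟨h4, h5⟩ := (latt_mem_sector_iff hab.det_pos).1 hq
  have hcr : q = det q b • a + det a q • b := by
    have : det a b • q = det q b • a + det a q • b := by
      ext <;> simp [det] <;> ring
    rwa [hV.det_eq_one a b hab, one_smul] at this
  have hφq : φ q = det q b • φ a + det a q • φ b := by
    apply latt_injective
    rw [latt_add, latt_smul, latt_smul, ← h.map_combination hV hΔ hab (by exact_mod_cast h5)
      (by exact_mod_cast h4), h.latt_apply, ← latt_smul, ← latt_smul, ← latt_add, ← hcr]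
  have h6 : det (φ a) (φ b) * det a q = 1 := by
    rw [← h1]
    conv_rhs => rw [hφq]
    simp [det]; ring
  have := Int.eq_one_of_mul_eq_one_right hpos.le h6
  exact hne this

end IsLatticeLift

/-! ### Orbits of rays -/

/-- The sectors of `V` reached by the orbits of the vectors of `V`: those which contain the image of
a vector of `V` in their interior, and those which are images of sectors already reached. -/
inductive Reached (φ : ℤ × ℤ → ℤ × ℤ) (V : Finset (ℤ × ℤ)) : ℤ × ℤ → ℤ × ℤ → Prop
  | enter {v a b : ℤ × ℤ} (hv : v ∈ V) (hab : Consecutive V a b) (hav : 0 < det a (φ v))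
      (hvb : 0 < det (φ v) b) : Reached φ V a b
  | map {a b : ℤ × ℤ} (h : Reached φ V a b) (hab : Consecutive V (φ a) (φ b)) :
      Reached φ V (φ a) (φ b)

/-- No sector reached by the orbit of a vector of `V` has an image that is subdivided by `V`. -/
def IsStable (φ : ℤ × ℤ → ℤ × ℤ) (V : Finset (ℤ × ℤ)) : Prop :=
  ∀ a b, Reached φ V a b → ∀ u ∈ V, ¬ (0 < det (φ a) u ∧ 0 < det u (φ b))

lemma Reached.consecutive {φ : ℤ × ℤ → ℤ × ℤ} {V : Finset (ℤ × ℤ)} {a b : ℤ × ℤ}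
    (h : Reached φ V a b) : Consecutive V a b := by
  cases h with
  | enter _ hab => exact hab
  | map _ hab => exact hab

section Stabilization

variable {F : Plane → Plane} {Δ₀ : Fan} {φ : ℤ × ℤ → ℤ × ℤ} {V Z : Finset (ℤ × ℤ)}

/-- The sums of the generators of the sectors along a chain of sectors that leads to the sector
of `a, b`. Since `φ` maps each sum to the next one, it maps all of them but the last into the set.
The sum at the start of the chain lies in `Z`, because the image of a vector of `V` in the interior
of the first sector does. -/
lemma Reached.exists_chain (h : IsLatticeLift F Δ₀ φ) (hV : IsRegularSystem V)
    (hΔ : Δ₀.rays ⊆ ray '' V) (hZ : IsRegularSystem Z) (hVZ : V ⊆ Z) (hφZ : ∀ v ∈ V, φ v ∈ Z)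
    {a b : ℤ × ℤ} (hab : Reached φ V a b) :
    ∃ M : Finset (ℤ × ℤ), a + b ∈ M ∧ (∀ m ∈ M, ∃ v w, Consecutive V v w ∧ m = v + w) ∧
      (∃ m ∈ M, m ∈ Z) ∧ ∀ m ∈ M, m ≠ a + b → φ m ∈ M := by
  classical
  induction hab with
  | @enter v a b hv hab hav hvb =>
    refine ⟨{a + b}, by simp, ?_, ⟨a + b, by simp, ?_⟩, ?_⟩
    · intro m hm
      exact ⟨a, b, hab, Finset.mem_singleton.1 hm⟩
    · exact hZ.add_mem (hVZ hab.left_mem) (hVZ hab.right_mem) (hφZ v hv)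
        (hV.det_eq_one a b hab) hav hvb
    · intro m hm hne
      exact absurd (Finset.mem_singleton.1 hm) hne
  | @map a b hab' hab ih =>
    obtain ⟨M, hM, hMV, ⟨m₀, hm₀, hm₀Z⟩, hMφ⟩ := ih
    refine ⟨insert (φ a + φ b) M, Finset.mem_insert_self _ _, ?_,
      ⟨m₀, Finset.mem_insert_of_mem hm₀, hm₀Z⟩, ?_⟩
    · intro m hm
      rcases Finset.mem_insert.1 hm with rfl | hm
      · exact ⟨_, _, hab, rfl⟩
      · exact hMV m hm
    · intro m hm hne
      have hm : m ∈ M := (Finset.mem_insert.1 hm).resolve_left hne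
      by_cases he : m = a + b
      · rw [he, h.map_add hV hΔ hab'.consecutive]
        exact Finset.mem_insert_self _ _
      · exact Finset.mem_insert_of_mem (hMφ m hm he)

/-- If a reached sector has an image that is subdivided by `V`, then subdividing all sectors of the
chain that leads to it decreases the number of vectors of `Z` that are missing in `V`. -/
lemma exists_card_sdiff_lt (h : IsLatticeLift F Δ₀ φ) (hV : IsRegularSystem V)
    (hΔ : Δ₀.rays ⊆ ray '' V) (hZ : IsRegularSystem Z) (hVZ : V ⊆ Z) (hφZ : ∀ v ∈ V, φ v ∈ Z)
    (hstable : ¬ IsStable φ V) :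
    ∃ V' Z' : Finset (ℤ × ℤ), V ⊆ V' ∧ IsRegularSystem V' ∧ IsRegularSystem Z' ∧ V' ⊆ Z' ∧
      (∀ v ∈ V', φ v ∈ Z') ∧ (Z' \ V').card < (Z \ V).card := by
  simp only [IsStable, not_forall, not_not] at hstable
  obtain ⟨a, b, hab, u, hu, hau, hub⟩ := hstable
  obtain ⟨M, -, hMV, ⟨m₀, hm₀, hm₀Z⟩, hMφ⟩ := hab.exists_chain h hV hΔ hZ hVZ hφZ
  have hadd : φ (a + b) ∈ Z := by
    rw [h.map_add hV hΔ hab.consecutive]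
    exact hZ.add_mem (hφZ a hab.consecutive.left_mem) (hφZ b hab.consecutive.right_mem) (hVZ hu)
      (h.det_apply_eq_one hV hΔ hab.consecutive) hau hub
  have hm₀V : m₀ ∉ V := by
    obtain ⟨v, w, hvw, rfl⟩ := hMV m₀ hm₀
    intro hmem
    refine hvw.not_inside _ hmem ⟨?_, ?_⟩
    · rw [det_add_right, det_self, zero_add]; exact hvw.det_pos
    · rw [det_add_left, det_self, add_zero]; exact hvw.det_pos
  refine ⟨V ∪ M, Z ∪ M, Finset.subset_union_left, hV.union_add ?_, hZ.union_add ?_,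
    Finset.union_subset_union_left hVZ, ?_, ?_⟩
  · intro m hm
    obtain ⟨v, w, hvw, rfl⟩ := hMV m hm
    exact ⟨v, w, hvw.left_mem, hvw.right_mem, hV.det_eq_one v w hvw, rfl⟩
  · intro m hm
    obtain ⟨v, w, hvw, rfl⟩ := hMV m hm
    exact ⟨v, w, hVZ hvw.left_mem, hVZ hvw.right_mem, hV.det_eq_one v w hvw, rfl⟩
  · intro v hv
    rcases Finset.mem_union.1 hv with hv | hv
    · exact Finset.mem_union_left _ (hφZ v hv)
    · by_cases he : v = a + b
      · exact Finset.mem_union_left _ (he ▸ hadd)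
      · exact Finset.mem_union_right _ (hMφ v hv he)
  · -- `m₀` lies in `Z` and in `V ∪ M`, but not in `V`.
    refine Finset.card_lt_card (Finset.ssubset_iff_subset_ne.2 ⟨?_, ?_⟩)
    · intro x hx
      simp only [Finset.mem_sdiff, Finset.mem_union] at hx ⊢
      tauto
    · intro heq
      have : m₀ ∈ (Z ∪ M) \ (V ∪ M) := heq ▸ Finset.mem_sdiff.2 ⟨hm₀Z, hm₀V⟩
      exact (Finset.mem_sdiff.1 this).2 (Finset.mem_union_right _ hm₀)

lemma exists_isStable (h : IsLatticeLift F Δ₀ φ) (hV : IsRegularSystem V)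
    (hΔ : Δ₀.rays ⊆ ray '' V) (hZ : IsRegularSystem Z) (hVZ : V ⊆ Z)
    (hφZ : ∀ v ∈ V, φ v ∈ Z) :
    ∃ V' : Finset (ℤ × ℤ), V ⊆ V' ∧ IsRegularSystem V' ∧ IsStable φ V' := by
  induction hn : (Z \ V).card using Nat.strong_induction_on generalizing V Z with
  | _ n ih =>
    by_cases hstable : IsStable φ V
    · exact ⟨V, subset_rfl, hV, hstable⟩
    · obtain ⟨V', Z', hVV', hV', hZ', hVZ', hφZ', hcard⟩ :=
        exists_card_sdiff_lt h hV hΔ hZ hVZ hφZ hstable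
      obtain ⟨W, hW, hW'⟩ := ih _ (hn ▸ hcard) hV'
        (hΔ.trans (Set.image_mono (Finset.coe_subset.2 hVV'))) hZ' hVZ' hφZ' rfl
      exact ⟨W, hVV'.trans hW, hW'⟩

end Stabilization

/-! ### The approximate map -/

lemma mem_approxMap {F : Plane → Plane} {Δ : Fan} {σ κ : Δ.cones}
    (h : IsLeast {κ : Δ.cones | F '' σ.1 ⊆ κ.1} κ) : κ ∈ approxMap F Δ Δ σ := by
  have hex : ∃ κ : Δ.cones, IsLeast {κ : Δ.cones | F '' σ.1 ⊆ κ.1} κ := ⟨κ, h⟩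
  exact ⟨hex, hex.choose_spec.unique h⟩

/-- The cones on the orbits of the rays: the rays themselves and the sectors reached. -/
def IsOrbitCone (φ : ℤ × ℤ → ℤ × ℤ) (V : Finset (ℤ × ℤ)) (σ : Set Plane) : Prop :=
  (∃ v ∈ V, σ = ray v) ∨ ∃ a b, Reached φ V a b ∧ σ = sector a b

lemma mem_approxMap_of_inside {F : Plane → Plane} {V : Finset (ℤ × ℤ)} (hV : IsRegularSystem V)
    {a b x : ℤ × ℤ} (hab : Consecutive V a b) (hax : 0 < det a x) (hxb : 0 < det x b)
    {σ : hV.toFan.cones} (hx : latt x ∈ F '' σ.1) (hσ : F '' σ.1 ⊆ sector a b) :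
    ⟨sector a b, hV.sector_mem_cones hab⟩ ∈ approxMap F hV.toFan hV.toFan σ :=
  mem_approxMap ⟨hσ, fun κ hκ => hV.sector_subset_of_mem_cones hab hax hxb κ.2 (hκ hx)⟩

/-- A primitive vector in a sector of `V` which does not belong to `V` lies in the interior of the
sector. -/
lemma IsRegularSystem.inside_of_mem_sector {V : Finset (ℤ × ℤ)} (hV : IsRegularSystem V)
    {a b x : ℤ × ℤ} (hab : Consecutive V a b) (hx : IsCoprime x.1 x.2) (hxV : x ∉ V)
    (hmem : latt x ∈ sector a b) : 0 < det a x ∧ 0 < det x b := by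
  obtain ⟨h1, h2⟩ := (latt_mem_sector_iff hab.det_pos).1 hmem
  have hcr : x = det x b • a + det a x • b := by
    have : det a b • x = det x b • a + det a x • b := by
      ext <;> simp [det] <;> ring
    rwa [hV.det_eq_one a b hab, one_smul] at this
  have key : ∀ (k : ℤ) (y : ℤ × ℤ), 0 ≤ k → y ∈ V → x ≠ k • y := by
    intro k y hk hy he
    have hunit : IsUnit k := hx.isUnit_of_dvd' ⟨y.1, by rw [he]; rfl⟩ ⟨y.2, by rw [he]; rfl⟩
    have : k = 1 := by rcases Int.isUnit_iff.1 hunit with h | h <;> omega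
    rw [this, one_smul] at he
    exact hxV (he ▸ hy)
  refine ⟨lt_of_le_of_ne h1 fun h0 => ?_, lt_of_le_of_ne h2 fun h0 => ?_⟩
  · rw [← h0, zero_smul, add_zero] at hcr
    exact key _ _ h2 hab.left_mem hcr
  · rw [← h0, zero_smul, zero_add] at hcr
    exact key _ _ h1 hab.right_mem hcr

lemma IsRegularSystem.exists_inside {V : Finset (ℤ × ℤ)} (hV : IsRegularSystem V) {x : ℤ × ℤ}
    (hx : IsCoprime x.1 x.2) (hxV : x ∉ V) :
    ∃ a b, Consecutive V a b ∧ 0 < det a x ∧ 0 < det x b := by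
  obtain ⟨a, b, hab, hmem⟩ := exists_consecutive hV.coords_subset (latt x)
  exact ⟨a, b, hab, hV.inside_of_mem_sector hab hx hxV hmem⟩

section Deterministic

variable {F : Plane → Plane} {Δ₀ : Fan} {φ : ℤ × ℤ → ℤ × ℤ} {V : Finset (ℤ × ℤ)}

/-- For a stable system, the approximate map is defined on the cones on the orbits of rays, and
its values are again such cones. -/
lemma IsOrbitCone.exists_mem_approxMap (h : IsLatticeLift F Δ₀ φ) (hV : IsRegularSystem V)
    (hΔ : Δ₀.rays ⊆ ray '' V) (hstable : IsStable φ V) {σ : hV.toFan.cones}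
    (hσ : IsOrbitCone φ V σ.1) :
    ∃ κ ∈ approxMap F hV.toFan hV.toFan σ, IsOrbitCone φ V κ.1 := by
  rcases hσ with ⟨v, hv, hσ⟩ | ⟨a, b, hab, hσ⟩
  · have himg : F '' σ.1 = ray (φ v) := by rw [hσ, h.image_ray]
    by_cases hmem : φ v ∈ V
    · exact ⟨⟨ray (φ v), hV.ray_mem_cones hmem⟩,
        mem_approxMap ⟨himg.subset, fun κ hκ => himg.superset.trans hκ⟩, Or.inl ⟨_, hmem, rfl⟩⟩
    · obtain ⟨a, b, hab, hav, hvb⟩ := hV.exists_inside (h.isCoprime (hV.isCoprime v hv)) hmem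
      refine ⟨_, mem_approxMap_of_inside hV hab hav hvb (himg.symm.subset (latt_mem_ray _)) ?_,
        Or.inr ⟨a, b, .enter hv hab hav hvb, rfl⟩⟩
      rw [himg]
      exact ray_subset_sector ((latt_mem_sector_iff hab.det_pos).2 ⟨hav.le, hvb.le⟩)
  · have hcons := hab.consecutive
    have himg : F '' σ.1 = sector (φ a) (φ b) := by rw [hσ, h.image_sector hV hΔ hcons]
    have hdet := h.det_apply_eq_one hV hΔ hcons
    have hno := hstable a b hab
    have h1 : det (φ a) (φ a + φ b) = 1 := by rw [det_add_right, det_self, hdet]; rfl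
    have h2 : det (φ a + φ b) (φ b) = 1 := by rw [det_add_left, det_self, hdet]; rfl
    have hsumV : φ a + φ b ∉ V := fun hmem => hno _ hmem ⟨by omega, by omega⟩
    obtain ⟨c, d, hcd, hcx, hxd⟩ := hV.exists_inside (isCoprime_of_det_eq_one h1) hsumV
    have hsub : sector (φ a) (φ b) ⊆ sector c d :=
      sector_subset_of_inside (by omega) (by omega : 0 < det (φ a) (φ a + φ b)) (by omega)
        hcd.det_pos hcx.le hxd.le (hno c hcd.left_mem) (hno d hcd.right_mem)
    refine ⟨_, mem_approxMap_of_inside hV hcd hcx hxd ?_ (himg.trans_subset hsub),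
      Or.inr ⟨c, d, ?_, rfl⟩⟩
    · rw [himg, latt_add]
      exact add_mem_sector (left_mem_sector _ _) (right_mem_sector _ _)
    · -- Either the image sector is the sector of `c, d`, or the image of `a` or `b` lies in the
      -- interior of the latter.
      by_cases ha : φ a ∈ V
      · by_cases hb : φ b ∈ V
        · have hcons' : Consecutive V (φ a) (φ b) := ⟨ha, hb, by omega, hno⟩
          have hsub' : sector c d ⊆ sector (φ a) (φ b) :=
            hV.sector_subset_of_mem_cones hcd hcx hxd (hV.sector_mem_cones hcons')
              (by rw [latt_add]
                  exact add_mem_sector (left_mem_sector _ _) (right_mem_sector _ _))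
          obtain ⟨p1, p2⟩ := (latt_mem_sector_iff hcd.det_pos).1 (hsub (left_mem_sector _ _))
          obtain ⟨p3, p4⟩ := (latt_mem_sector_iff hcd.det_pos).1 (hsub (right_mem_sector _ _))
          obtain ⟨q1, q2⟩ :=
            (latt_mem_sector_iff hcons'.det_pos).1 (hsub' (left_mem_sector _ _))
          obtain ⟨q3, q4⟩ :=
            (latt_mem_sector_iff hcons'.det_pos).1 (hsub' (right_mem_sector _ _))
          have s1 := det_swap c (φ a)
          have s2 := det_swap d (φ b)
          have e1 : φ a = c := eq_of_det_eq_zero (x := φ a + φ b) (hV.isCoprime _ ha)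
            (hV.isCoprime _ hcd.left_mem) (by omega) (by omega) hcx
          have e2 : φ b = d := by
            refine eq_of_det_eq_zero (x := -(φ a + φ b)) (hV.isCoprime _ hb)
              (hV.isCoprime _ hcd.right_mem) (by omega) ?_ ?_
            · rw [show det (φ b) (-(φ a + φ b)) = det (φ a + φ b) (φ b) by simp [det]; ring]
              omega
            · rwa [show det d (-(φ a + φ b)) = det (φ a + φ b) d by simp [det]; ring]
          rw [← e1, ← e2]
          exact .map hab hcons'
        · obtain ⟨p1, p2⟩ := hV.inside_of_mem_sector hcd
            (h.isCoprime (hV.isCoprime b hcons.right_mem)) hb (hsub (right_mem_sector _ _))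
          exact .enter hcons.right_mem hcd p1 p2
      · obtain ⟨p1, p2⟩ := hV.inside_of_mem_sector hcd
          (h.isCoprime (hV.isCoprime a hcons.left_mem)) ha (hsub (left_mem_sector _ _))
        exact .enter hcons.left_mem hcd p1 p2

lemma exists_mem_approxIter (h : IsLatticeLift F Δ₀ φ) (hV : IsRegularSystem V)
    (hΔ : Δ₀.rays ⊆ ray '' V) (hstable : IsStable φ V) {σ : hV.toFan.cones}
    (hσ : IsOrbitCone φ V σ.1) (j : ℕ) :
    ∃ κ ∈ approxIter F hV.toFan j σ, IsOrbitCone φ V κ.1 := by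
  induction j with
  | zero => exact ⟨σ, Part.mem_some σ, hσ⟩
  | succ j ih =>
    obtain ⟨κ, hκ, hκ'⟩ := ih
    obtain ⟨ρ, hρ, hρ'⟩ := hκ'.exists_mem_approxMap h hV hΔ hstable
    exact ⟨ρ, Part.mem_bind hκ hρ, hρ'⟩

end Deterministic

end PLFan

open PLFan in
theorem mainTheorem3 (F : PLFan.Plane → PLFan.Plane) (hF : PLFan.IsPLAut F)
    (Δ : PLFan.Fan) :
    ∃ Δ' : PLFan.Fan, Δ'.Refines Δ ∧ Δ'.Regular ∧ Δ'.Compatible F ∧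
      ∀ τ : Δ'.cones, (τ : Set PLFan.Plane) ∈ Δ'.rays → PLFan.Deterministic F Δ' τ := by
  classical
  obtain ⟨-, Δ₀, hΔ₀⟩ := hF.piecewiseLinear
  have hlift : ∀ v, ∃ w, latt w = F (latt v) := fun v => by
    have : F (latt v) ∈ F '' Set.range latt := ⟨_, ⟨v, rfl⟩, rfl⟩
    rwa [hF.image_lattice] at this
  choose φ hφ using hlift
  have h : IsLatticeLift F Δ₀ φ := ⟨hF, hΔ₀, hφ⟩
  obtain ⟨S, hS, hSΔ⟩ := Δ.exists_primitive_finset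
  obtain ⟨S₀, hS₀, hSΔ₀⟩ := Δ₀.exists_primitive_finset
  obtain ⟨N, hN, hSN⟩ := exists_subset_primitiveBox (S ∪ S₀) fun v hv =>
    (Finset.mem_union.1 hv).elim (hS v) (hS₀ v)
  have hV := isRegularSystem_primitiveBox hN
  obtain ⟨K, hK, hNK⟩ := exists_subset_primitiveBox
    (primitiveBox N ∪ (primitiveBox N).image φ) fun v hv => by
      rcases Finset.mem_union.1 hv with hv | hv
      · exact hV.isCoprime v hv
      · obtain ⟨w, hw, rfl⟩ := Finset.mem_image.1 hv
        exact h.isCoprime (hV.isCoprime w hw)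
  have hΔ₀N : Δ₀.rays ⊆ ray '' (primitiveBox N) := hSΔ₀.trans
    (Set.image_mono (Finset.coe_subset.2 (Finset.subset_union_right.trans hSN)))
  obtain ⟨V, hNV, hVreg, hstable⟩ := exists_isStable h hV hΔ₀N (isRegularSystem_primitiveBox hK)
    (Finset.subset_union_left.trans hNK)
    (fun v hv => hNK (Finset.mem_union_right _ (Finset.mem_image_of_mem φ hv)))
  have hΔ₀V : Δ₀.rays ⊆ ray '' V := hΔ₀N.trans (Set.image_mono (Finset.coe_subset.2 hNV))
  have hΔV : Δ.rays ⊆ ray '' V := hSΔ.trans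
    (Set.image_mono (Finset.coe_subset.2 ((Finset.subset_union_left.trans hSN).trans hNV)))
  refine ⟨hVreg.toFan, hVreg.refines_toFan hΔV, hVreg.regular_toFan, ?_, ?_⟩
  · intro σ hσ
    obtain ⟨a, b, hab, rfl⟩ := hVreg.mem_sectors_toFan.1 hσ
    obtain ⟨L, -, hL⟩ := h.exists_linear hVreg hΔ₀V hab
    exact ⟨L, hL⟩
  · rintro τ ⟨v, hv, hτ⟩ j -
    obtain ⟨κ, hκ, -⟩ := exists_mem_approxIter h hVreg hΔ₀V hstable (Or.inl ⟨v, hv, hτ.symm⟩) j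
    exact Part.dom_iff_mem.2 ⟨κ, hκ⟩
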